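/- A family of $k<mn$ vectors $|\phi_1\rangle,\dots,|\phi_k\rangle\in\mathbb{C}^m\otimes\mathbb{C}^n$ is called an unextendible product basis (UPB) if (i) every $|\phi_i\rangle$ is a product state, i.e. a nonzero vector of the form $|a\rangle\otimes|b\rangle$; (ii) $\langle\phi_i|\phi_j\rangle=\delta_{ij}$ for all $i,j$; and (iii) no product state is orthogonal to all of $|\phi_1\rangle,\dots,|\phi_k\rangle$. Its missing states number is $mn-k$. Let $m\ge 4$ and $n\ge 10$ be integers. Then for every integer $l$ with $4\le l\le (m-1)(n-8)$ there is a UPB in $\mathbb{C}^m\otimes\mathbb{C}^n$ with missing states number $l$. -/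

import Mathlib

open scoped TensorProduct

/-- The bipartite Hilbert space `ℂ^m ⊗ ℂ^n`, with Mathlib's inner product on the tensor product:
`⟪a ⊗ b, c ⊗ d⟫ = ⟪a, c⟫ * ⟪b, d⟫`. -/
abbrev Bipartite (m n : ℕ) : Type :=
  EuclideanSpace ℂ (Fin m) ⊗[ℂ] EuclideanSpace ℂ (Fin n)

/-- A product state, up to normalization: a nonzero vector of the form `a ⊗ b`. -/
def IsProductState {m n : ℕ} (ψ : Bipartite m n) : Prop :=
  ψ ≠ 0 ∧ ∃ (a : EuclideanSpace ℂ (Fin m)) (b : EuclideanSpace ℂ (Fin n)), ψ = a ⊗ₜ[ℂ] b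

/-- A `k`-member unextendible product basis (UPB) in `ℂ^m ⊗ ℂ^n`. -/
structure IsUPB {m n k : ℕ} (φ : Fin k → Bipartite m n) : Prop where
  card_lt : k < m * n
  isProductState : ∀ i, IsProductState (φ i)
  orthonormal : Orthonormal ℂ φ
  unextendible : ∀ ψ : Bipartite m n, (∀ i, inner ℂ (φ i) ψ = 0) → ¬ IsProductState ψ

/-- There is a UPB in `ℂ^m ⊗ ℂ^n` whose missing states number `m * n - k` (with `k` its number of
members) is `l`; the subtraction does not truncate, since a UPB has `k < m * n`. -/
def ExistsUPBWithMissing (m n l : ℕ) : Prop :=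
  ∃ (k : ℕ) (φ : Fin k → Bipartite m n), IsUPB φ ∧ m * n - k = l

/-!
Work with orthogonal families of product vectors that no product vector extends, complete product
bases included, and record the codimension of their span. Placing families of `ℂ^m ⊗ ℂ^n` and
`ℂ^m ⊗ ℂ^n'` side by side in `ℂ^m ⊗ (ℂ^n ⊕ ℂ^n')` adds the codimensions, and a complete basis
contributes `0`, so a few building blocks suffice.

The large blocks have the least possible size `m + n - 1 = 2 * h`, hence codimension
`(m - 1) * (n - 1)`. Their members are products of weighted moment vectors at the `h`-th roots of
`1` and of `-1`, whose inner products are values at `conj z * w` of a polynomial `P` (left factor)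
or `W` (right factor). If `W` vanishes at the `h`-th roots of unity other than `1`, and `P` and `W`
share out the `h`-th roots of `-1`, the family is orthogonal. On the right the weights are square
roots of the coefficients of `W`, so these must be positive; on the left the coefficients of `P`
only need to be nonzero, being carried by the roots of `-1` alone. Gaussian binomial polynomials
at `q = exp (2πi / h)` have consecutive `h`-th roots of `±1` as their roots and positive
coefficients, which provides `P` and `W`; for odd `h` the root `-1` may be moved from `W` to `P`,
which changes the parity of `m`. The family cannot be extended once any `m` left and any `n` right
vectors span: on the right this is a Vandermonde determinant, and on the left it holds after a
generic scaling `τ ^ j` of the `j`-th coordinate of one class and `τ ^ (-j)` of the other, which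
preserves the inner products between the classes.

For a given `l`, large blocks leave a remainder between `4` and `3 * (m - 1)`, which is realised
in seven further columns by families in dimension `3` or `4`.
-/

open Filter Topology ComplexConjugate Polynomial

section UnextendibleFamily

variable {𝕜 E E' F F' G ι κ : Type*} [RCLike 𝕜]
  [NormedAddCommGroup E] [InnerProductSpace 𝕜 E] [NormedAddCommGroup E'] [InnerProductSpace 𝕜 E']
  [NormedAddCommGroup F] [InnerProductSpace 𝕜 F] [NormedAddCommGroup F'] [InnerProductSpace 𝕜 F']
  [NormedAddCommGroup G] [InnerProductSpace 𝕜 G]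

variable (𝕜) in
/-- The product vectors `a i ⊗ b i` are nonzero, pairwise orthogonal, and not all orthogonal to a
nonzero product vector `u ⊗ v`. Everything is phrased on the factors, through
`⟪a ⊗ b, u ⊗ v⟫ = ⟪a, u⟫ * ⟪b, v⟫`, and complete product bases are allowed. -/
structure IsUnextendibleFamily (a : ι → E) (b : ι → F) : Prop where
  left_ne_zero : ∀ i, a i ≠ 0
  right_ne_zero : ∀ i, b i ≠ 0
  orthogonal : Pairwise fun i j => inner 𝕜 (a i) (a j) = 0 ∨ inner 𝕜 (b i) (b j) = 0
  unextendible : ∀ u v, (∀ i, inner 𝕜 (a i) u = 0 ∨ inner 𝕜 (b i) v = 0) → u = 0 ∨ v = 0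

namespace IsUnextendibleFamily

variable {a : ι → E} {b : ι → F}

theorem swap (h : IsUnextendibleFamily 𝕜 a b) : IsUnextendibleFamily 𝕜 b a where
  left_ne_zero := h.right_ne_zero
  right_ne_zero := h.left_ne_zero
  orthogonal _ _ hij := (h.orthogonal hij).symm
  unextendible u v huv := (h.unextendible v u fun i => (huv i).symm).symm

theorem comp_equiv (h : IsUnextendibleFamily 𝕜 a b) (e : κ ≃ ι) :
    IsUnextendibleFamily 𝕜 (a ∘ e) (b ∘ e) where
  left_ne_zero i := h.left_ne_zero (e i)
  right_ne_zero i := h.right_ne_zero (e i)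
  orthogonal := h.orthogonal.comp_of_injective e.injective
  unextendible u v huv := h.unextendible u v (e.forall_congr_right.1 huv)

theorem map (h : IsUnextendibleFamily 𝕜 a b) (f : E ≃ₗᵢ[𝕜] E') (g : F ≃ₗᵢ[𝕜] F') :
    IsUnextendibleFamily 𝕜 (f ∘ a) (g ∘ b) where
  left_ne_zero i := by simpa using h.left_ne_zero i
  right_ne_zero i := by simpa using h.right_ne_zero i
  orthogonal i j hij := by simpa using h.orthogonal hij
  unextendible u v huv := by
    simpa using h.unextendible (f.symm u) (g.symm v) fun i => by
      simpa [LinearIsometryEquiv.inner_map_eq_flip] using huv i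

theorem smul (h : IsUnextendibleFamily 𝕜 a b) {c d : ι → 𝕜} (hc : ∀ i, c i ≠ 0)
    (hd : ∀ i, d i ≠ 0) :
    IsUnextendibleFamily 𝕜 (fun i => c i • a i) (fun i => d i • b i) where
  left_ne_zero i := smul_ne_zero (hc i) (h.left_ne_zero i)
  right_ne_zero i := smul_ne_zero (hd i) (h.right_ne_zero i)
  orthogonal i j hij := by
    simpa [inner_smul_left, inner_smul_right, hc, hd] using h.orthogonal hij
  unextendible u v huv := h.unextendible u v fun i => by
    simpa [inner_smul_left, hc, hd] using huv i

theorem of_orthonormalBasis [Fintype ι] [Fintype κ] (e : OrthonormalBasis ι 𝕜 E)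
    (f : OrthonormalBasis κ 𝕜 F) :
    IsUnextendibleFamily 𝕜 (fun p : ι × κ => e p.1) (fun p => f p.2) where
  left_ne_zero p := e.orthonormal.ne_zero p.1
  right_ne_zero p := f.orthonormal.ne_zero p.2
  orthogonal p q hpq := by
    by_cases h : p.1 = q.1
    · exact Or.inr (f.inner_eq_zero fun h' => hpq (Prod.ext h h'))
    · exact Or.inl (e.inner_eq_zero h)
  unextendible u v huv := by
    by_contra! hne
    obtain ⟨i, hi⟩ : ∃ i, inner 𝕜 (e i) u ≠ 0 := by
      by_contra! hi
      exact hne.1 (InnerProductSpace.ext_inner_left_basis e.toBasis fun i => by simpa using hi i)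
    exact hne.2 (InnerProductSpace.ext_inner_left_basis f.toBasis fun j => by
      simpa using (huv (i, j)).resolve_left hi)

theorem sum_right (h : IsUnextendibleFamily 𝕜 a b) {a' : κ → E} {b' : κ → G}
    (h' : IsUnextendibleFamily 𝕜 a' b') :
    IsUnextendibleFamily 𝕜 (Sum.elim a a') (Sum.elim
      (fun i => WithLp.toLp 2 (b i, (0 : G))) (fun i => WithLp.toLp 2 ((0 : F), b' i))) where
  left_ne_zero := Sum.forall.2 ⟨h.left_ne_zero, h'.left_ne_zero⟩
  right_ne_zero := Sum.forall.2 ⟨fun i => by simpa using h.right_ne_zero i, fun i => by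
    simpa using h'.right_ne_zero i⟩
  orthogonal := by
    rintro (i | i) (j | j) hij
    · simpa using h.orthogonal (by simpa using hij)
    · simp
    · simp
    · simpa using h'.orthogonal (by simpa using hij)
  unextendible u v huv := by
    obtain ⟨hl, hr⟩ := Sum.forall.1 huv
    refine or_iff_not_imp_left.2 fun hu => (WithLp.ofLp_eq_zero 2).1 (Prod.ext ?_ ?_)
    · exact (h.unextendible u v.fst fun i => by simpa using hl i).resolve_left hu
    · exact (h'.unextendible u v.snd fun i => by simpa using hr i).resolve_left hu

end IsUnextendibleFamily

end UnextendibleFamily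

theorem IsUnextendibleFamily.isUPB {m n k : ℕ} {a : Fin k → EuclideanSpace ℂ (Fin m)}
    {b : Fin k → EuclideanSpace ℂ (Fin n)} (h : IsUnextendibleFamily ℂ a b)
    (ha : ∀ i, ‖a i‖ = 1) (hb : ∀ i, ‖b i‖ = 1) (hk : k < m * n) :
    IsUPB fun i => a i ⊗ₜ[ℂ] b i := by
  have hnorm i : ‖a i ⊗ₜ[ℂ] b i‖ = 1 := by rw [TensorProduct.norm_tmul, ha, hb, one_mul]
  refine ⟨hk, fun i => ⟨norm_ne_zero_iff.1 (by simp [hnorm]), _, _, rfl⟩,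
    ⟨hnorm, fun i j hij => ?_⟩, ?_⟩
  · simpa [TensorProduct.inner_tmul] using h.orthogonal hij
  · rintro _ hψ ⟨hne, u, v, rfl⟩
    rcases h.unextendible u v fun i => by simpa [TensorProduct.inner_tmul] using hψ i with rfl | rfl
    · exact hne (TensorProduct.zero_tmul _ _)
    · exact hne (TensorProduct.tmul_zero _ _)

/-- Some unextendible orthogonal family of product vectors in `ℂ^m ⊗ ℂ^n` spans a subspace of
codimension `l`; for `l = 0` this is a complete product basis. -/
def AttainsCodim (m n l : ℕ) : Prop :=
  ∃ (k : ℕ) (a : Fin k → EuclideanSpace ℂ (Fin m)) (b : Fin k → EuclideanSpace ℂ (Fin n)),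
    IsUnextendibleFamily ℂ a b ∧ k + l = m * n

theorem IsUnextendibleFamily.attainsCodim {E F ι : Type*} [NormedAddCommGroup E]
    [InnerProductSpace ℂ E] [FiniteDimensional ℂ E] [NormedAddCommGroup F] [InnerProductSpace ℂ F]
    [FiniteDimensional ℂ F] [Fintype ι] {a : ι → E} {b : ι → F} (h : IsUnextendibleFamily ℂ a b)
    {m n l : ℕ} (hm : Module.finrank ℂ E = m) (hn : Module.finrank ℂ F = n)
    (hl : Fintype.card ι + l = m * n) : AttainsCodim m n l := by
  subst hm hn
  exact ⟨_, _, _, (h.map (stdOrthonormalBasis ℂ E).repr (stdOrthonormalBasis ℂ F).repr).comp_equiv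
    (Fintype.equivFin ι).symm, hl⟩

namespace AttainsCodim

variable {m m' n n' l l' : ℕ}

theorem swap (h : AttainsCodim m n l) : AttainsCodim n m l := by
  obtain ⟨k, a, b, hab, hk⟩ := h
  exact ⟨k, b, a, hab.swap, by rw [hk, mul_comm]⟩

theorem zero (m n : ℕ) : AttainsCodim m n 0 :=
  (IsUnextendibleFamily.of_orthonormalBasis (EuclideanSpace.basisFun (Fin m) ℂ)
    (EuclideanSpace.basisFun (Fin n) ℂ)).attainsCodim finrank_euclideanSpace_fin
    finrank_euclideanSpace_fin (by simp)

theorem add_cols (h : AttainsCodim m n l) (h' : AttainsCodim m n' l') :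
    AttainsCodim m (n + n') (l + l') := by
  obtain ⟨k, a, b, hab, hk⟩ := h
  obtain ⟨k', a', b', hab', hk'⟩ := h'
  refine (hab.sum_right hab').attainsCodim finrank_euclideanSpace_fin ?_ ?_
  · rw [(WithLp.linearEquiv 2 ℂ _).finrank_eq, Module.finrank_prod, finrank_euclideanSpace_fin,
      finrank_euclideanSpace_fin]
  · rw [Fintype.card_sum, Fintype.card_fin, Fintype.card_fin]
    linarith

theorem add_rows (h : AttainsCodim m n l) (h' : AttainsCodim m' n l') :
    AttainsCodim (m + m') n (l + l') :=
  (h.swap.add_cols h'.swap).swap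

theorem mono (h : AttainsCodim m n l) (hm : m ≤ m') (hn : n ≤ n') : AttainsCodim m' n' l := by
  obtain ⟨x, rfl⟩ := Nat.exists_eq_add_of_le hm
  obtain ⟨y, rfl⟩ := Nat.exists_eq_add_of_le hn
  exact (h.add_rows (zero x n)).add_cols (zero _ y)

theorem existsUPBWithMissing (h : AttainsCodim m n l) (hl : 0 < l) :
    ExistsUPBWithMissing m n l := by
  obtain ⟨k, a, b, hab, hk⟩ := h
  have ha i : ((‖a i‖⁻¹ : ℝ) : ℂ) ≠ 0 := by simpa using hab.left_ne_zero i
  have hb i : ((‖b i‖⁻¹ : ℝ) : ℂ) ≠ 0 := by simpa using hab.right_ne_zero i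
  refine ⟨k, _, (hab.smul ha hb).isUPB (fun i => ?_) (fun i => ?_) (by omega), by omega⟩
  · simpa using norm_smul_inv_norm (𝕜 := ℂ) (hab.left_ne_zero i)
  · simpa using norm_smul_inv_norm (𝕜 := ℂ) (hab.right_ne_zero i)

end AttainsCodim

theorem attainsCodim_of_int {m n k l : ℕ} (a : Fin k → Fin m → ℤ) (b : Fin k → Fin n → ℤ)
    (ha : ∀ i, a i ≠ 0) (hb : ∀ i, b i ≠ 0)
    (hab : ∀ i j, i ≠ j → a i ⬝ᵥ a j = 0 ∨ b i ⬝ᵥ b j = 0) (hk : k + l = m * n)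
    (hu : ∀ (u : Fin m → ℂ) (v : Fin n → ℂ),
      (∀ i, ∑ x, (a i x : ℂ) * u x = 0 ∨ ∑ y, (b i y : ℂ) * v y = 0) →
        (∀ x, u x = 0) ∨ ∀ y, v y = 0) :
    AttainsCodim m n l := by
  let toVec {p : ℕ} (x : Fin p → ℤ) : EuclideanSpace ℂ (Fin p) := WithLp.toLp 2 fun i => (x i : ℂ)
  have toVec_ne_zero {p : ℕ} {x : Fin p → ℤ} (hx : x ≠ 0) : toVec x ≠ 0 := fun h =>
    hx (funext fun i => by simpa [toVec] using congrArg (· i) h)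
  have inner_toVec {p : ℕ} (x : Fin p → ℤ) (u : EuclideanSpace ℂ (Fin p)) :
      inner ℂ (toVec x) u = ∑ i, (x i : ℂ) * u i := by
    simp [toVec, PiLp.inner_apply, mul_comm]
  have inner_toVec_toVec {p : ℕ} {x y : Fin p → ℤ} (h : x ⬝ᵥ y = 0) :
      inner ℂ (toVec x) (toVec y) = 0 := by
    simpa [inner_toVec, toVec, dotProduct] using congrArg (Int.cast : ℤ → ℂ) h
  refine ⟨k, fun i => toVec (a i), fun i => toVec (b i),
    ⟨fun i => toVec_ne_zero (ha i), fun i => toVec_ne_zero (hb i), fun i j hij =>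
      (hab i j hij).imp inner_toVec_toVec inner_toVec_toVec, fun u v h => ?_⟩, hk⟩
  exact (hu u v (by simpa only [inner_toVec] using h)).imp (PiLp.ext ·) (PiLp.ext ·)

theorem attainsCodim_three_three : AttainsCodim 3 3 4 := by
  refine attainsCodim_of_int (k := 5)
    ![![1, 1, 1], ![1, 0, -1], ![1, -1, 0], ![0, 1, 0], ![0, 0, 1]]
    ![![1, 1, 1], ![0, 1, 0], ![0, 0, 1], ![1, -1, 0], ![1, 0, -1]]
    (by decide) (by decide) (by decide) rfl fun u v h => ?_
  simp only [Fin.forall_fin_succ, IsEmpty.forall_iff, Fin.succ_zero_eq_one, Fin.succ_one_eq_two,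
    Fin.reduceSucc, Fin.sum_univ_three, Matrix.cons_val, Int.cast_zero,
    Int.cast_one, Int.cast_neg] at h ⊢
  grind

theorem attainsCodim_three_four : AttainsCodim 3 4 5 := by
  refine attainsCodim_of_int (k := 7)
    ![![1, 1, 1], ![1, 0, 0], ![1, 0, -1], ![1, -1, 0], ![0, 1, 0], ![0, 1, -1], ![0, 0, 1]]
    ![![1, 1, 1, 1], ![1, -1, 0, 0], ![0, 0, 1, 0], ![0, 0, 0, 1], ![1, 0, -1, 0], ![0, 1, 0, 0],
      ![1, 0, 0, -1]]
    (by decide) (by decide) (by decide) rfl fun u v h => ?_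
  simp only [Fin.forall_fin_succ, IsEmpty.forall_iff, Fin.succ_zero_eq_one, Fin.succ_one_eq_two,
    Fin.reduceSucc, Fin.sum_univ_three, Fin.sum_univ_four, Matrix.cons_val, Int.cast_zero,
    Int.cast_one, Int.cast_neg] at h ⊢
  grind

theorem attainsCodim_four_four : AttainsCodim 4 4 7 := by
  refine attainsCodim_of_int (k := 9)
    ![![1, 1, 1, 1], ![1, 0, -1, 0], ![1, 0, 0, 0], ![1, -1, 0, 0], ![0, 1, 0, 0], ![0, 1, 0, -1],
      ![0, 0, 1, -1], ![0, 0, 1, 0], ![0, 0, 0, 1]]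
    ![![1, 1, 1, 1], ![1, 0, 0, 0], ![0, 1, 0, -1], ![0, 0, 1, 0], ![1, -1, 0, 0], ![0, 0, 0, 1],
      ![0, 1, 0, 0], ![0, 0, 1, -1], ![1, 0, -1, 0]]
    (by decide) (by decide) (by decide) rfl fun u v h => ?_
  simp only [Fin.forall_fin_succ, IsEmpty.forall_iff, Fin.succ_zero_eq_one, Fin.succ_one_eq_two,
    Fin.reduceSucc, Fin.sum_univ_four, Matrix.cons_val, Int.cast_zero,
    Int.cast_one, Int.cast_neg] at h ⊢
  grind

section GeneralPosition

variable {𝕜 E F ι : Type*} [RCLike 𝕜] [NormedAddCommGroup E] [InnerProductSpace 𝕜 E]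
  [NormedAddCommGroup F] [InnerProductSpace 𝕜 F]

variable (𝕜) in
/-- A family is in general position when any `dim E` of its members span `E`; spanning is expressed
by the triviality of the orthogonal complement. -/
def IsInGeneralPosition (a : ι → E) : Prop :=
  ∀ T : Finset ι, Module.finrank 𝕜 E ≤ T.card → ∀ u, (∀ i ∈ T, inner 𝕜 (a i) u = 0) → u = 0

theorem isInGeneralPosition_of_card_eq {a : ι → E}
    (h : ∀ T : Finset ι, T.card = Module.finrank 𝕜 E →
      ∀ u, (∀ i ∈ T, inner 𝕜 (a i) u = 0) → u = 0) :
    IsInGeneralPosition 𝕜 a := fun T hT u hu => by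
  obtain ⟨S, hST, hS⟩ := Finset.exists_subset_card_eq hT
  exact h S hS u fun i hi => hu i (hST hi)

theorem IsInGeneralPosition.eq_zero_or_eq_zero [Fintype ι] {a : ι → E} {b : ι → F}
    (ha : IsInGeneralPosition 𝕜 a) (hb : IsInGeneralPosition 𝕜 b)
    (hcard : Module.finrank 𝕜 E + Module.finrank 𝕜 F ≤ Fintype.card ι + 1) (u : E) (v : F)
    (huv : ∀ i, inner 𝕜 (a i) u = 0 ∨ inner 𝕜 (b i) v = 0) : u = 0 ∨ v = 0 := by
  classical
  let T : Finset ι := {i | inner 𝕜 (a i) u = 0}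
  have hTc : T.card + Tᶜ.card = Fintype.card ι := Finset.card_add_card_compl T
  rcases le_or_gt (Module.finrank 𝕜 E) T.card with hT | hT
  · exact Or.inl (ha T hT u fun i hi => by simpa [T] using hi)
  · exact Or.inr (hb Tᶜ (by omega) v fun i hi => (huv i).resolve_left (by simpa [T] using hi))

end GeneralPosition

section MomentVec

variable {m : ℕ} {c d : ℕ → ℝ} {ι : Type*}

/-- The point of parameter `z` on the moment curve of `ℂ^m` with weights `c`, with coordinates
`c j * z ^ j`. -/
noncomputable def momentVec (m : ℕ) (c : ℕ → ℝ) (z : ℂ) : EuclideanSpace ℂ (Fin m) :=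
  WithLp.toLp 2 fun j => c j * z ^ (j : ℕ)

theorem inner_momentVec (z : ℂ) (u : EuclideanSpace ℂ (Fin m)) :
    inner ℂ (momentVec m c z) u = ∑ j : Fin m, c j * conj z ^ (j : ℕ) * u j := by
  simp [momentVec, PiLp.inner_apply, mul_comm]

theorem inner_momentVec_momentVec {P : ℝ[X]} (hP : P.natDegree < m)
    (hcd : ∀ j < m, c j * d j = P.coeff j) (z w : ℂ) :
    inner ℂ (momentVec m c z) (momentVec m d w) = aeval (conj z * w) P := by
  rw [inner_momentVec, aeval_eq_sum_range' hP, Finset.sum_range]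
  refine Finset.sum_congr rfl fun j _ => ?_
  rw [← hcd j j.isLt]
  simp [momentVec, mul_pow]
  ring

theorem momentVec_ne_zero (hm : 0 < m) (hc : c 0 ≠ 0) (z : ℂ) : momentVec m c z ≠ 0 := fun h =>
  hc (by simpa [momentVec] using congrArg (· ⟨0, hm⟩) h)

theorem isInGeneralPosition_momentVec {x : ι → ℂ} (hx : Function.Injective x)
    (hc : ∀ j < m, c j ≠ 0) : IsInGeneralPosition ℂ fun i => momentVec m c (x i) := by
  refine isInGeneralPosition_of_card_eq fun T hT u hu => PiLp.ext fun j => ?_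
  rw [finrank_euclideanSpace_fin] at hT
  let e := (T.equivFinOfCardEq hT).symm
  have hinj : Function.Injective fun i => conj (x (e i)) :=
    (starRingEnd ℂ).injective.comp (hx.comp (Subtype.val_injective.comp e.injective))
  have key : (fun j : Fin m => (c j : ℂ) * u j) = 0 :=
    Matrix.eq_zero_of_forall_index_sum_pow_mul_eq_zero hinj fun i => by
      rw [← hu (e i) (e i).2, inner_momentVec]
      exact Finset.sum_congr rfl fun j _ => by ring
  simpa [hc j j.isLt] using congrFun key j

end MomentVec

section TwistedVandermonde

variable {k l : ℕ} {x : Fin k → ℂ} {y : Fin l → ℂ} {p : ℕ → ℝ}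

/-- The rows `τ ^ j * x i ^ j` and `τ ^ (-j) * p j * y i ^ j`, after the columns and rows have been
rescaled by powers of `τ` that remove all negative exponents; at `τ = 0` it is block diagonal. -/
noncomputable def twistedVandermonde (x : Fin k → ℂ) (y : Fin l → ℂ) (p : ℕ → ℝ) (τ : ℝ) :
    Matrix (Fin k ⊕ Fin l) (Fin k ⊕ Fin l) ℂ :=
  Matrix.fromBlocks (Matrix.vandermonde x)
    (Matrix.of fun i j => (τ : ℂ) ^ (2 * (j : ℕ) + 1) * x i ^ (k + j : ℕ))
    (Matrix.of fun i j => (τ : ℂ) ^ (2 * (j.rev : ℕ) + 1) * (p j * y i ^ (j : ℕ)))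
    (Matrix.of fun i j => p (k + j) * y i ^ (k + j : ℕ))

theorem continuous_twistedVandermonde : Continuous (twistedVandermonde x y p) := by
  refine .matrix_fromBlocks continuous_const ?_ ?_ continuous_const <;>
  · refine continuous_matrix fun i j => ?_
    simp only [Matrix.of_apply]
    fun_prop

theorem det_twistedVandermonde_zero_ne_zero (hx : Function.Injective x)
    (hy : Function.Injective y) (hy0 : ∀ i, y i ≠ 0) (hp : ∀ j < k + l, p j ≠ 0) :
    (twistedVandermonde x y p 0).det ≠ 0 := by
  have hblock : (Matrix.of fun i j : Fin l => (p (k + j) : ℂ) * y i ^ (k + j : ℕ)) =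
      Matrix.diagonal (fun i => y i ^ k) * Matrix.vandermonde y *
        Matrix.diagonal (fun j : Fin l => (p (k + j) : ℂ)) := by
    ext i j
    rw [Matrix.mul_diagonal, Matrix.diagonal_mul, Matrix.vandermonde_apply, Matrix.of_apply,
      pow_add, mul_comm]
  have hzero : (Matrix.of fun (i : Fin l) (j : Fin k) =>
      ((0 : ℝ) : ℂ) ^ (2 * (j.rev : ℕ) + 1) * (p j * y i ^ (j : ℕ))) = 0 := by
    ext i j
    simp
  rw [twistedVandermonde, hzero, Matrix.det_fromBlocks_zero₂₁, hblock, Matrix.det_mul,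
    Matrix.det_mul, Matrix.det_diagonal, Matrix.det_diagonal]
  refine mul_ne_zero (Matrix.det_vandermonde_ne_zero_iff.2 hx) (mul_ne_zero (mul_ne_zero ?_
    (Matrix.det_vandermonde_ne_zero_iff.2 hy)) ?_)
  · exact Finset.prod_ne_zero_iff.2 fun i _ => pow_ne_zero k (hy0 i)
  · exact Finset.prod_ne_zero_iff.2 fun j _ => Complex.ofReal_ne_zero.2 (hp _ (by omega))

theorem twistedVandermonde_mulVec {τ : ℝ} (hτ : τ ≠ 0) {u : Fin (k + l) → ℂ}
    (hux : ∀ i, ∑ j : Fin (k + l), (τ : ℂ) ^ (j : ℕ) * x i ^ (j : ℕ) * u j = 0)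
    (huy : ∀ i, ∑ j : Fin (k + l), ((τ : ℂ) ^ (j : ℕ))⁻¹ * p j * y i ^ (j : ℕ) * u j = 0) :
    (twistedVandermonde x y p τ).mulVec
      (Sum.elim (fun j => (τ : ℂ) ^ (j + 1 : ℕ) * u (Fin.castAdd l j))
        fun j => (τ : ℂ) ^ k * ((τ : ℂ) ^ (j : ℕ))⁻¹ * u (Fin.natAdd k j)) = 0 := by
  have hτ' : (τ : ℂ) ≠ 0 := Complex.ofReal_ne_zero.2 hτ
  have hrev (j : Fin k) : (τ : ℂ) ^ (2 * (j.rev : ℕ) + 1) * (τ : ℂ) ^ (j + 1 : ℕ) =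
      (τ : ℂ) ^ (2 * k) * ((τ : ℂ) ^ (j : ℕ))⁻¹ := by
    rw [eq_mul_inv_iff_mul_eq₀ (pow_ne_zero _ hτ'), ← pow_add, ← pow_add, Fin.val_rev]
    congr 1
    omega
  ext (i | i)
  · calc
      _ = τ * ∑ j : Fin (k + l), (τ : ℂ) ^ (j : ℕ) * x i ^ (j : ℕ) * u j := by
        rw [Fin.sum_univ_add, mul_add, Finset.mul_sum, Finset.mul_sum]
        simp only [twistedVandermonde, Matrix.mulVec, dotProduct, Fintype.sum_sum_type,
          Matrix.fromBlocks_apply₁₁, Matrix.fromBlocks_apply₁₂, Matrix.vandermonde_apply,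
          Matrix.of_apply, Sum.elim_inl, Sum.elim_inr, Fin.val_castAdd, Fin.val_natAdd]
        congr 1 <;> refine Finset.sum_congr rfl fun j _ => ?_
        · ring
        · field_simp
          ring
      _ = 0 := by rw [hux, mul_zero]
  · calc
      _ = (τ : ℂ) ^ (2 * k) *
          ∑ j : Fin (k + l), ((τ : ℂ) ^ (j : ℕ))⁻¹ * p j * y i ^ (j : ℕ) * u j := by
        rw [Fin.sum_univ_add, mul_add, Finset.mul_sum, Finset.mul_sum]
        simp only [twistedVandermonde, Matrix.mulVec, dotProduct, Fintype.sum_sum_type,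
          Matrix.fromBlocks_apply₂₁, Matrix.fromBlocks_apply₂₂,
          Matrix.of_apply, Sum.elim_inl, Sum.elim_inr, Fin.val_castAdd, Fin.val_natAdd]
        congr 1 <;> refine Finset.sum_congr rfl fun j _ => ?_
        · linear_combination (p j * y i ^ (j : ℕ) * u (Fin.castAdd l j)) * hrev j
        · field_simp
          ring
      _ = 0 := by rw [huy, mul_zero]

theorem eventually_twisted_sums_injective (hx : Function.Injective x)
    (hy : Function.Injective y) (hy0 : ∀ i, y i ≠ 0) (hp : ∀ j < k + l, p j ≠ 0) :
    ∀ᶠ τ : ℝ in 𝓝[≠] 0, ∀ u : Fin (k + l) → ℂ,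
      (∀ i, ∑ j : Fin (k + l), (τ : ℂ) ^ (j : ℕ) * x i ^ (j : ℕ) * u j = 0) →
      (∀ i, ∑ j : Fin (k + l), ((τ : ℂ) ^ (j : ℕ))⁻¹ * p j * y i ^ (j : ℕ) * u j = 0) → u = 0 := by
  have hdet : ∀ᶠ τ : ℝ in 𝓝[≠] 0, (twistedVandermonde x y p τ).det ≠ 0 :=
    nhdsWithin_le_nhds (continuous_twistedVandermonde.matrix_det.continuousAt.eventually_ne
      (det_twistedVandermonde_zero_ne_zero hx hy hy0 hp))
  filter_upwards [hdet, self_mem_nhdsWithin] with τ hτdet hτ u hux huy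
  have hτ' : (τ : ℂ) ≠ 0 := Complex.ofReal_ne_zero.2 hτ
  have hv := Matrix.eq_zero_of_mulVec_eq_zero hτdet (twistedVandermonde_mulVec hτ hux huy)
  refine funext (Fin.addCases (fun j => ?_) fun j => ?_)
  · simpa [hτ'] using congrFun hv (Sum.inl j)
  · simpa [hτ'] using congrFun hv (Sum.inr j)

end TwistedVandermonde

theorem exists_isInGeneralPosition_momentVec {m : ℕ} {ι κ : Type*} [Finite ι] [Finite κ]
    {x : ι → ℂ} {y : κ → ℂ} (hx : Function.Injective x) (hy : Function.Injective y)
    (hy0 : ∀ i, y i ≠ 0) {p : ℕ → ℝ} (hp : ∀ j < m, p j ≠ 0) :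
    ∃ τ : ℝ, τ ≠ 0 ∧ IsInGeneralPosition ℂ (Sum.elim (fun i => momentVec m (τ ^ ·) (x i))
      fun i => momentVec m (fun j => (τ ^ j)⁻¹ * p j) (y i)) := by
  suffices h : ∀ᶠ τ : ℝ in 𝓝[≠] 0, ∀ T : Finset (ι ⊕ κ), T.card = m →
      ∀ u : EuclideanSpace ℂ (Fin m), (∀ i ∈ T, inner ℂ (Sum.elim
        (fun i => momentVec m (τ ^ ·) (x i))
        (fun i => momentVec m (fun j => (τ ^ j)⁻¹ * p j) (y i)) i) u = 0) → u = 0 by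
    obtain ⟨τ, hτ, hτ0⟩ := (h.and self_mem_nhdsWithin).exists
    exact ⟨τ, hτ0, isInGeneralPosition_of_card_eq fun T hT =>
      hτ T (hT.trans finrank_euclideanSpace_fin)⟩
  refine eventually_all.2 fun T => eventually_imp_distrib_left.2 fun hT => ?_
  obtain rfl : T.toLeft.card + T.toRight.card = m := by rw [Finset.card_toLeft_add_card_toRight, hT]
  let e := T.toLeft.equivFin.symm
  let f := T.toRight.equivFin.symm
  have hx' : Function.Injective fun i => conj (x (e i)) :=
    (starRingEnd ℂ).injective.comp (hx.comp (Subtype.val_injective.comp e.injective))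
  have hy' : Function.Injective fun i => conj (y (f i)) :=
    (starRingEnd ℂ).injective.comp (hy.comp (Subtype.val_injective.comp f.injective))
  filter_upwards [eventually_twisted_sums_injective hx' hy' (fun i => by simpa using hy0 _) hp]
    with τ hτ u hu
  refine (WithLp.ofLp_eq_zero 2).1 (hτ u (fun i => ?_) fun i => ?_)
  · simpa [inner_momentVec] using hu _ (Finset.mem_toLeft.1 (e i).2)
  · simpa [inner_momentVec] using hu _ (Finset.mem_toRight.1 (f i).2)

/-! ### Families of moment vectors at the roots of `1` and `-1` -/

theorem conj_mul_eq_one_iff {z w : ℂ} (hz : ‖z‖ = 1) : conj z * w = 1 ↔ z = w := by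
  rw [← Complex.inv_eq_conj hz, inv_mul_eq_one₀ (norm_ne_zero_iff.1 (hz ▸ one_ne_zero))]

theorem coeff_geom_sum (h j : ℕ) :
    (∑ i ∈ Finset.range h, (X : ℝ[X]) ^ i).coeff j = if j < h then 1 else 0 := by
  simp [finsetSum_coeff, coeff_X_pow]

theorem coeff_geom_sum_mul_pos {h d : ℕ} (hh : 0 < h) {V : ℝ[X]} (hV : V.natDegree ≤ d)
    (hVpos : ∀ j ≤ d, 0 < V.coeff j) {j : ℕ} (hj : j < h + d) :
    0 < ((∑ i ∈ Finset.range h, X ^ i) * V).coeff j := by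
  rw [coeff_mul]
  refine Finset.sum_pos' (fun x _ => mul_nonneg ?_ ?_) ⟨(j - d, min j d), ?_, ?_⟩
  · rw [coeff_geom_sum]
    positivity
  · rcases le_or_gt x.2 d with hx | hx
    · exact (hVpos _ hx).le
    · exact (coeff_eq_zero_of_natDegree_lt (by omega)).ge
  · rw [Finset.HasAntidiagonal.mem_antidiagonal]
    omega
  · rw [coeff_geom_sum, if_pos (by omega), one_mul]
    exact hVpos _ (min_le_right _ _)

theorem natDegree_geom_sum_mul_lt {h d : ℕ} (hh : 0 < h) {V : ℝ[X]} (hV : V.natDegree ≤ d) :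
    ((∑ i ∈ Finset.range h, X ^ i) * V).natDegree < h + d := by
  have hgeom : (∑ i ∈ Finset.range h, (X : ℝ[X]) ^ i).natDegree ≤ h - 1 :=
    natDegree_le_iff_coeff_eq_zero.2 fun j hj => by rw [coeff_geom_sum, if_neg (by omega)]
  have := natDegree_mul_le_of_le hgeom hV
  omega

theorem aeval_geom_sum_mul_eq_zero {h : ℕ} {z : ℂ} (hz : z ^ h = 1) (hz1 : z ≠ 1) (V : ℝ[X]) :
    aeval z ((∑ i ∈ Finset.range h, X ^ i) * V) = 0 := by
  have hgeom := geom_sum_mul z h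
  rw [hz, sub_self] at hgeom
  simp [(mul_eq_zero.1 hgeom).resolve_right (sub_ne_zero.2 hz1)]

/- The moment vectors at all `h`-th roots of `1` and `-1` form the family. Two roots of the same
class are orthogonal on the right, where `conj z * w` is a nontrivial `h`-th root of unity; for two
roots of different classes it is an `h`-th root of `-1`. -/
theorem attainsCodim_of_aeval_eq_zero {h m n : ℕ} (hm : 0 < m) (hn : 0 < n)
    (hcard : m + n = 2 * h + 1) {x y : Fin h → ℂ} (hx : Function.Injective x)
    (hy : Function.Injective y) (hxh : ∀ i, x i ^ h = 1) (hyh : ∀ i, y i ^ h = -1) {P W : ℝ[X]}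
    (hP : P.natDegree < m) (hP0 : ∀ j < m, P.coeff j ≠ 0) (hW : W.natDegree < n)
    (hWpos : ∀ j < n, 0 < W.coeff j) (hW1 : ∀ z : ℂ, z ^ h = 1 → z ≠ 1 → aeval z W = 0)
    (hPW : ∀ z : ℂ, z ^ h = -1 → aeval z P = 0 ∨ aeval z W = 0) :
    AttainsCodim m n ((m - 1) * (n - 1)) := by
  have hh (i : Fin h) : h ≠ 0 := by have := i.isLt; omega
  have hxn i : ‖x i‖ = 1 := Complex.norm_eq_one_of_pow_eq_one (hxh i) (hh i)
  have hyn i : ‖y i‖ = 1 := by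
    rw [← pow_eq_one_iff_of_nonneg (norm_nonneg _) (hh i), ← norm_pow, hyh, norm_neg, norm_one]
  have hxy : Function.Injective (Sum.elim x y) := hx.sumElim hy fun i j hij => by
    have := (hxh i).symm.trans ((congrArg (· ^ h) hij).trans (hyh j))
    norm_num at this
  have hy0 i : y i ≠ 0 := norm_ne_zero_iff.1 (by rw [hyn]; exact one_ne_zero)
  obtain ⟨τ, hτ, hgen⟩ := exists_isInGeneralPosition_momentVec hx hy hy0 hP0
  have hleft i j := inner_momentVec_momentVec hP (c := (τ ^ ·))
    (d := fun j => (τ ^ j)⁻¹ * P.coeff j) (fun k _ => mul_inv_cancel_left₀ (pow_ne_zero k hτ) _)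
    (x i) (y j)
  have hright := inner_momentVec_momentVec hW (c := fun j => √(W.coeff j))
    fun j hj => Real.mul_self_sqrt (hWpos j hj).le
  have hsqrt j (hj : j < n) : √(W.coeff j) ≠ 0 := (Real.sqrt_pos.2 (hWpos j hj)).ne'
  have hmixed i j := hPW (conj (x i) * y j) (by rw [mul_pow, ← map_pow, hxh, hyh]; simp)
  refine IsUnextendibleFamily.attainsCodim ⟨?_, fun i => momentVec_ne_zero hn (hsqrt 0 hn) _, ?_,
    hgen.eq_zero_or_eq_zero (isInGeneralPosition_momentVec hxy hsqrt) (by simp; omega)⟩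
    finrank_euclideanSpace_fin finrank_euclideanSpace_fin ?_
  · exact Sum.forall.2 ⟨fun i => momentVec_ne_zero hm (by simp) _,
      fun i => momentVec_ne_zero hm (c := fun j => (τ ^ j)⁻¹ * P.coeff j)
        (by simpa using hP0 0 hm) _⟩
  · rintro (i | i) (j | j) hij
    · refine Or.inr ((hright _ _).trans (hW1 _ ?_ ?_))
      · simp [mul_pow, ← map_pow, hxh]
      · exact mt (conj_mul_eq_one_iff (hxn i)).1 (hx.ne (by simpa using hij))
    · exact (hmixed i j).imp (hleft i j).trans (hright _ _).trans
    · exact (hmixed j i).imp (fun h0 => inner_eq_zero_symm.1 ((hleft j i).trans h0))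
        fun h0 => inner_eq_zero_symm.1 ((hright _ _).trans h0)
    · refine Or.inr ((hright _ _).trans (hW1 _ ?_ ?_))
      · simp [mul_pow, ← map_pow, hyh]
      · exact mt (conj_mul_eq_one_iff (hyn i)).1 (hy.ne (by simpa using hij))
  · obtain ⟨m, rfl⟩ := Nat.exists_eq_add_one.2 hm
    obtain ⟨n, rfl⟩ := Nat.exists_eq_add_one.2 hn
    simp only [Fintype.card_sum, Fintype.card_fin, Nat.add_sub_cancel]
    linarith

theorem attainsCodim_of_coeff {h m d : ℕ} (hm : 0 < m) (hh : 0 < h) (hmd : m + d = h + 1)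
    {P V : ℝ[X]} (hP : P.natDegree < m) (hP0 : ∀ j < m, P.coeff j ≠ 0) (hV : V.natDegree ≤ d)
    (hVpos : ∀ j ≤ d, 0 < V.coeff j)
    (hPV : ∀ z : ℂ, z ^ h = -1 → aeval z P = 0 ∨ aeval z V = 0) :
    AttainsCodim m (h + d) ((m - 1) * (h + d - 1)) := by
  have hω := Complex.isPrimitiveRoot_exp h hh.ne'
  set ω := Complex.exp (2 * Real.pi * Complex.I / h)
  have hωinj : Function.Injective fun k : Fin h => ω ^ (k : ℕ) := fun i j hij =>
    Fin.ext (hω.pow_inj i.isLt j.isLt hij)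
  have hωpow (k : Fin h) : (ω ^ (k : ℕ)) ^ h = 1 := by rw [pow_right_comm, hω.pow_eq_one, one_pow]
  let ε := Complex.exp (Real.pi * Complex.I / h)
  have hε : ε ^ h = -1 := by
    rw [← Complex.exp_nat_mul, mul_div_cancel₀ _ (Nat.cast_ne_zero.2 hh.ne'),
      Complex.exp_pi_mul_I]
  exact attainsCodim_of_aeval_eq_zero hm (by omega) (by omega) hωinj
    ((mul_right_injective₀ (Complex.exp_ne_zero _ : ε ≠ 0)).comp hωinj) hωpow
    (fun k => (mul_pow ε _ h).trans (by rw [hωpow, mul_one, hε]))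
    hP hP0 (natDegree_geom_sum_mul_lt hh hV)
    (fun j => coeff_geom_sum_mul_pos hh hV hVpos)
    (fun z hz hz1 => aeval_geom_sum_mul_eq_zero hz hz1 V)
    fun z hz => (hPV z hz).imp_right fun h0 => by rw [map_mul, h0, mul_zero]

/-! ### Gaussian binomial coefficients -/

theorem sin_lt_sin_of_add_lt_pi {a b : ℝ} (ha : 0 ≤ a) (hab : a < b) (h : a + b < Real.pi) :
    Real.sin a < Real.sin b := by
  rcases le_total b (Real.pi / 2) with hb | hb
  · exact Real.sin_lt_sin_of_lt_of_le_pi_div_two (by linarith [Real.pi_pos]) hb hab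
  · rw [← Real.sin_pi_sub b]
    exact Real.sin_lt_sin_of_lt_of_le_pi_div_two (by linarith [Real.pi_pos]) (by linarith)
      (by linarith)

theorem exp_mul_sin_add_exp_mul_sin (a b : ℝ) :
    Complex.exp (a * Complex.I) * Complex.sin b + Complex.exp (-(b * Complex.I)) * Complex.sin a =
      Complex.sin (a + b) := by
  rw [← neg_mul, Complex.exp_mul_I, Complex.exp_mul_I, Complex.cos_neg, Complex.sin_neg,
    Complex.sin_add]
  ring

section Gaussian

variable {θ : ℝ} {M j : ℕ}

/-- The symmetric Gaussian binomial coefficient `[M choose j]` at `q = exp (2θi)`, in which the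
`q`-integer `[k]` is `sin (kθ) / sin θ`. -/
noncomputable def gaussCoeff (θ : ℝ) (M j : ℕ) : ℝ :=
  ∏ i ∈ Finset.range j, Real.sin ((M - i) * θ) / Real.sin ((i + 1) * θ)

@[simp]
theorem gaussCoeff_zero_right (θ : ℝ) (M : ℕ) : gaussCoeff θ M 0 = 1 := rfl

theorem gaussCoeff_eq_zero (hj : M < j) : gaussCoeff θ M j = 0 :=
  Finset.prod_eq_zero (Finset.mem_range.2 hj) (by simp)

theorem sin_natCast_mul_pos (hθ : 0 < θ) (hM : M * θ < Real.pi) (hj : 0 < j) (hjM : j ≤ M) :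
    0 < Real.sin (j * θ) := by
  refine Real.sin_pos_of_pos_of_lt_pi (by positivity) (lt_of_le_of_lt ?_ hM)
  gcongr

theorem gaussCoeff_pos (hθ : 0 < θ) (hM : M * θ < Real.pi) (hj : j ≤ M) :
    0 < gaussCoeff θ M j := by
  refine Finset.prod_pos fun i hi => ?_
  have hi' := Finset.mem_range.1 hi
  have hnum := sin_natCast_mul_pos hθ hM (j := M - i) (by omega) (by omega)
  have hden := sin_natCast_mul_pos hθ hM (j := i + 1) (by omega) (by omega)
  push_cast [show i ≤ M by omega] at hnum hden
  exact div_pos hnum hden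

theorem gaussCoeff_succ_mul_sin (hθ : 0 < θ) (hM : M * θ < Real.pi) (j : ℕ) :
    gaussCoeff θ M (j + 1) * Real.sin ((j + 1) * θ) =
      gaussCoeff θ M j * Real.sin ((M - j) * θ) := by
  rcases lt_trichotomy j M with hj | rfl | hj
  · have hden := sin_natCast_mul_pos hθ hM (j := j + 1) (by omega) (by omega)
    push_cast at hden
    rw [gaussCoeff, Finset.prod_range_succ, mul_assoc, div_mul_cancel₀ _ hden.ne', gaussCoeff]
  · simp [gaussCoeff_eq_zero]
  · rw [gaussCoeff_eq_zero hj, gaussCoeff_eq_zero (hj.trans (Nat.lt_succ_self j)), zero_mul,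
      zero_mul]

theorem gaussCoeff_succ_succ_mul_sin (hθ : 0 < θ) (hM : (M + 1 : ℕ) * θ < Real.pi) (j : ℕ) :
    gaussCoeff θ (M + 1) (j + 1) * Real.sin ((j + 1) * θ) =
      gaussCoeff θ M j * Real.sin ((M + 1) * θ) := by
  rcases le_or_gt j M with hj | hj
  · have hden := sin_natCast_mul_pos hθ hM (j := j + 1) (by omega) (by omega)
    push_cast at hden
    rw [gaussCoeff, gaussCoeff, Finset.prod_div_distrib, Finset.prod_div_distrib,
      Finset.prod_range_succ', Finset.prod_range_succ (fun i : ℕ => Real.sin ((i + 1) * θ))]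
    simp only [Nat.cast_add, Nat.cast_one, Nat.cast_zero, sub_zero, add_sub_add_right_eq_sub]
    rw [mul_div_mul_comm, mul_assoc, div_mul_cancel₀ _ hden.ne']
  · rw [gaussCoeff_eq_zero hj, gaussCoeff_eq_zero (Nat.succ_lt_succ hj), zero_mul, zero_mul]

/- The `q`-Pascal rule: by the recursions above, after multiplication by `sin ((j + 1) * θ)` it is
the addition formula for `(M - j) * θ` and `(j + 1) * θ`. -/
theorem gaussCoeff_succ_succ (hθ : 0 < θ) (hM : (M + 1 : ℕ) * θ < Real.pi) (j : ℕ) :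
    (gaussCoeff θ (M + 1) (j + 1) : ℂ) =
      Complex.exp (M * θ * Complex.I) * Complex.exp (-(θ * Complex.I)) ^ j * gaussCoeff θ M j +
        Complex.exp (-(θ * Complex.I)) ^ (j + 1) * gaussCoeff θ M (j + 1) := by
  rcases le_or_gt j M with hj | hj
  · have hden := sin_natCast_mul_pos hθ hM (j := j + 1) (by omega) (by omega)
    have hM' : M * θ < Real.pi := lt_of_le_of_lt (by gcongr; omega) hM
    have hpascal := gaussCoeff_succ_succ_mul_sin hθ hM j
    have hrec := gaussCoeff_succ_mul_sin hθ hM' j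
    have hadd := exp_mul_sin_add_exp_mul_sin ((M - j) * θ) ((j + 1) * θ)
    have hexp : Complex.exp (M * θ * Complex.I) * Complex.exp (-(θ * Complex.I)) ^ j =
        Complex.exp (((M - j) * θ : ℝ) * Complex.I) := by
      rw [← Complex.exp_nat_mul, ← Complex.exp_add]
      congr 1
      push_cast
      ring
    have hexp' : Complex.exp (-(θ * Complex.I)) ^ (j + 1) =
        Complex.exp (-(((j + 1) * θ : ℝ) * Complex.I)) := by
      rw [← Complex.exp_nat_mul]
      congr 1
      push_cast
      ring
    have hsin : Complex.sin ((j + 1 : ℝ) * θ : ℝ) ≠ 0 := by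
      rw [← Complex.ofReal_sin]
      exact_mod_cast hden.ne'
    refine mul_right_cancel₀ hsin ?_
    rw [hexp, hexp']
    apply_fun ((↑) : ℝ → ℂ) at hpascal hrec
    push_cast at hpascal hrec hadd ⊢
    rw [show ((M : ℂ) - j) * θ + (j + 1) * θ = (M + 1) * θ by ring] at hadd
    linear_combination hpascal - gaussCoeff θ M j * hadd -
      Complex.exp (-((j + 1) * θ * Complex.I)) * hrec
  · rw [gaussCoeff_eq_zero hj, gaussCoeff_eq_zero (Nat.succ_lt_succ hj),
      gaussCoeff_eq_zero (hj.trans (Nat.lt_succ_self j))]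
    simp

theorem gaussCoeff_lt_succ (hθ : 0 < θ) (hM : (M + 1 : ℕ) * θ < Real.pi) (hj : 2 * j + 1 < M) :
    gaussCoeff θ M j < gaussCoeff θ M (j + 1) := by
  have hM' : M * θ < Real.pi := lt_of_le_of_lt (by gcongr; omega) hM
  have hden := sin_natCast_mul_pos hθ hM' (j := j + 1) (by omega) (by omega)
  push_cast at hden hM
  refine lt_of_mul_lt_mul_right ?_ hden.le
  rw [gaussCoeff_succ_mul_sin hθ hM']
  refine mul_lt_mul_of_pos_left (sin_lt_sin_of_add_lt_pi (by positivity) ?_ (by linarith))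
    (gaussCoeff_pos hθ hM' (by omega))
  gcongr
  rify at hj
  linarith

theorem gaussCoeff_succ_lt (hθ : 0 < θ) (hM : (M + 1 : ℕ) * θ < Real.pi) (hj : M < 2 * j + 1)
    (hjM : j < M) : gaussCoeff θ M (j + 1) < gaussCoeff θ M j := by
  have hM' : M * θ < Real.pi := lt_of_le_of_lt (by gcongr; omega) hM
  have hden := sin_natCast_mul_pos hθ hM' (j := j + 1) (by omega) (by omega)
  push_cast at hden hM
  rify at hj hjM
  refine lt_of_mul_lt_mul_right ?_ hden.le
  rw [gaussCoeff_succ_mul_sin hθ hM']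
  refine mul_lt_mul_of_pos_left (sin_lt_sin_of_add_lt_pi (mul_nonneg (by linarith) hθ.le) ?_
    (by linarith)) (gaussCoeff_pos hθ hM' (by exact_mod_cast hjM.le))
  gcongr
  linarith

/-- The Gaussian binomial polynomial `∑ j, [M choose j] X ^ j` at `q = exp (2θi)`. -/
noncomputable def gaussPoly (θ : ℝ) (M : ℕ) : ℝ[X] :=
  ∑ j ∈ Finset.range (M + 1), C (gaussCoeff θ M j) * X ^ j

@[simp]
theorem coeff_gaussPoly (θ : ℝ) (M j : ℕ) : (gaussPoly θ M).coeff j = gaussCoeff θ M j := by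
  simp only [gaussPoly, finsetSum_coeff, coeff_C_mul, coeff_X_pow, mul_ite, mul_one, mul_zero,
    Finset.sum_ite_eq, Finset.mem_range, ite_eq_left_iff, not_lt]
  exact fun hj => (gaussCoeff_eq_zero hj).symm

theorem natDegree_gaussPoly_le (θ : ℝ) (M : ℕ) : (gaussPoly θ M).natDegree ≤ M :=
  natDegree_le_iff_coeff_eq_zero.2 fun j hj => by rw [coeff_gaussPoly, gaussCoeff_eq_zero hj]

theorem aeval_gaussPoly {n : ℕ} (hn : M < n) (z : ℂ) :
    aeval z (gaussPoly θ M) = ∑ j ∈ Finset.range n, gaussCoeff θ M j * z ^ j := by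
  simp [aeval_eq_sum_range' ((natDegree_gaussPoly_le θ M).trans_lt hn)]

theorem aeval_gaussPoly_succ (hθ : 0 < θ) (hM : (M + 1 : ℕ) * θ < Real.pi) (z : ℂ) :
    aeval z (gaussPoly θ (M + 1)) = (Complex.exp (M * θ * Complex.I) * z + 1) *
      aeval (Complex.exp (-(θ * Complex.I)) * z) (gaussPoly θ M) := by
  calc
    _ = ∑ j ∈ Finset.range (M + 1), gaussCoeff θ (M + 1) (j + 1) * z ^ (j + 1) + 1 := by
      rw [aeval_gaussPoly (Nat.lt_succ_self _), Finset.sum_range_succ']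
      simp
    _ = Complex.exp (M * θ * Complex.I) * z *
          (∑ j ∈ Finset.range (M + 1),
            gaussCoeff θ M j * (Complex.exp (-(θ * Complex.I)) * z) ^ j) +
        ((∑ j ∈ Finset.range (M + 1),
          gaussCoeff θ M (j + 1) * (Complex.exp (-(θ * Complex.I)) * z) ^ (j + 1)) + 1) := by
      rw [Finset.mul_sum, ← add_assoc, ← Finset.sum_add_distrib]
      refine congrArg (· + 1) (Finset.sum_congr rfl fun j _ => ?_)
      rw [gaussCoeff_succ_succ hθ hM]
      ring
    _ = _ := by
      rw [add_mul, one_mul, ← aeval_gaussPoly (Nat.lt_succ_self M),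
        aeval_gaussPoly (Nat.lt_succ_of_lt (Nat.lt_succ_self M)), Finset.sum_range_succ']
      simp

theorem aeval_gaussPoly_eq_prod (hθ : 0 < θ) (hM : M * θ < Real.pi) (z : ℂ) :
    aeval z (gaussPoly θ M) =
      ∏ k ∈ Finset.range M, (z + Complex.exp ((2 * k + 1 - M) * θ * Complex.I)) := by
  induction M generalizing z with
  | zero => simp [gaussPoly]
  | succ M ih =>
    have hM' : M * θ < Real.pi := lt_of_le_of_lt (by gcongr; omega) hM
    have hfactor (k : ℕ) : Complex.exp (-(θ * Complex.I)) * z +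
        Complex.exp ((2 * k + 1 - M) * θ * Complex.I) = Complex.exp (-(θ * Complex.I)) *
          (z + Complex.exp ((2 * (k + 1 : ℕ) + 1 - (M + 1 : ℕ)) * θ * Complex.I)) := by
      rw [mul_add, ← Complex.exp_add]
      congr 2
      push_cast
      ring
    have hfirst : Complex.exp (M * θ * Complex.I) * z + 1 = Complex.exp (M * θ * Complex.I) *
        (z + Complex.exp ((2 * (0 : ℕ) + 1 - (M + 1 : ℕ)) * θ * Complex.I)) := by
      rw [mul_add, ← Complex.exp_add, show M * θ * Complex.I + _ = 0 by push_cast; ring,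
        Complex.exp_zero]
    have hcancel : Complex.exp (-(θ * Complex.I)) ^ M * Complex.exp (M * θ * Complex.I) = 1 := by
      rw [← Complex.exp_nat_mul, ← Complex.exp_add, show _ + _ = (0 : ℂ) by ring, Complex.exp_zero]
    rw [aeval_gaussPoly_succ hθ hM, ih hM', Finset.prod_congr rfl fun k _ => hfactor k,
      Finset.prod_mul_distrib, Finset.prod_const, Finset.card_range, Finset.prod_range_succ',
      hfirst]
    linear_combination (z + Complex.exp ((2 * (0 : ℕ) + 1 - (M + 1 : ℕ)) * θ * Complex.I)) *
      (∏ k ∈ Finset.range M, (z + Complex.exp ((2 * (k + 1 : ℕ) + 1 - (M + 1 : ℕ)) * θ *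
        Complex.I))) * hcancel

theorem aeval_gaussPoly_eq_zero (hθ : 0 < θ) (hM : M * θ < Real.pi) {k : ℕ} (hk : k < M) {z : ℂ}
    (hz : z = -Complex.exp ((2 * k + 1 - M) * θ * Complex.I)) : aeval z (gaussPoly θ M) = 0 := by
  rw [aeval_gaussPoly_eq_prod hθ hM]
  exact Finset.prod_eq_zero (Finset.mem_range.2 hk) (by rw [hz, neg_add_cancel])

end Gaussian

/-! ### Large blocks -/

theorem exists_eq_exp_of_pow_eq_neg_one {h : ℕ} (hh : 0 < h) (s : ℕ) {z : ℂ} (hz : z ^ h = -1) :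
    ∃ k < h, z = Complex.exp ((2 * k + 1 - (2 * s : ℕ)) * (Real.pi / h : ℝ) * Complex.I) := by
  have : NeZero h := ⟨hh.ne'⟩
  have hhc : (h : ℂ) ≠ 0 := NeZero.ne _
  have hroot : (z * Complex.exp ((2 * s - 1) * (Real.pi / h : ℝ) * Complex.I)) ^ h = 1 := by
    have hexp : h * ((2 * s - 1) * (Real.pi / h : ℝ) * Complex.I) =
        s * (2 * Real.pi * Complex.I) - Real.pi * Complex.I := by
      push_cast
      field_simp
    rw [mul_pow, hz, ← Complex.exp_nat_mul, hexp, Complex.exp_sub,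
      Complex.exp_nat_mul_two_pi_mul_I, Complex.exp_pi_mul_I]
    norm_num
  obtain ⟨k, hk, hzk⟩ := (Complex.isPrimitiveRoot_exp h hh.ne').eq_pow_of_pow_eq_one hroot
  refine ⟨k, hk, ?_⟩
  rw [eq_div_of_mul_eq (Complex.exp_ne_zero _) hzk.symm, ← Complex.exp_nat_mul, ← Complex.exp_sub]
  congr 1
  push_cast
  ring

theorem natCast_mul_pi_div_lt_pi {M h : ℕ} (hM : M < h) : M * (Real.pi / h) < Real.pi := by
  rw [← mul_div_assoc, div_lt_iff₀ (Nat.cast_pos.2 (by omega)), mul_comm]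
  gcongr

theorem aeval_gaussPoly_eq_zero_or {h s : ℕ} (hs : 0 < s) (hsh : 2 * s < h) {z : ℂ}
    (hz : z ^ h = -1) :
    aeval (-z) (gaussPoly (Real.pi / h) (2 * s)) = 0 ∨
      aeval z (gaussPoly (Real.pi / h) (h - 2 * s)) = 0 := by
  have hhc : (h : ℂ) ≠ 0 := Nat.cast_ne_zero.2 (by omega)
  have hθ : 0 < Real.pi / h := div_pos Real.pi_pos (Nat.cast_pos.2 (by omega))
  obtain ⟨k, hk, hzk⟩ := exists_eq_exp_of_pow_eq_neg_one (by omega) s hz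
  rcases lt_or_ge k (2 * s) with hks | hks
  · exact Or.inl (aeval_gaussPoly_eq_zero hθ (natCast_mul_pi_div_lt_pi hsh) hks (neg_inj.2 hzk))
  · refine Or.inr (aeval_gaussPoly_eq_zero hθ (natCast_mul_pi_div_lt_pi (by omega))
      (k := k - 2 * s) (by omega) ?_)
    rw [hzk, ← Complex.exp_add_pi_mul_I]
    congr 1
    push_cast [hks, hsh.le]
    field_simp
    ring

theorem coeff_pos_of_coeff_lt_coeff_succ {f g : ℝ[X]} (hfg : f = (X + 1) * g) {t : ℕ}
    (h0 : 0 < f.coeff 0) (hf : ∀ j < t, f.coeff j < f.coeff (j + 1)) {j : ℕ} (hj : j ≤ t) :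
    0 < g.coeff j := by
  have hsucc (j : ℕ) : f.coeff (j + 1) = g.coeff j + g.coeff (j + 1) := by
    rw [hfg, add_mul, one_mul, coeff_add, coeff_X_mul]
  suffices h : 0 < g.coeff j ∧ g.coeff j ≤ f.coeff j from h.1
  induction j with
  | zero => simpa [hfg, add_mul] using h0
  | succ j ih =>
    have := ih (by omega)
    have := hf j hj
    constructor <;> linarith [hsucc j]

theorem coeff_pos_of_coeff_succ_lt_coeff {f g : ℝ[X]} (hfg : f = (X + 1) * g) {t N : ℕ}
    (hg : g.natDegree ≤ N) (hN : 0 < f.coeff (N + 1))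
    (hf : ∀ j, t < j → j ≤ N → f.coeff (j + 1) < f.coeff j) {j : ℕ} (htj : t ≤ j) (hj : j ≤ N) :
    0 < g.coeff j := by
  have hsucc (j : ℕ) : f.coeff (j + 1) = g.coeff j + g.coeff (j + 1) := by
    rw [hfg, add_mul, one_mul, coeff_add, coeff_X_mul]
  suffices h : 0 < g.coeff j ∧ g.coeff j ≤ f.coeff (j + 1) from h.1
  induction hj using Nat.decreasingInduction with
  | self => simpa [hsucc, coeff_eq_zero_of_natDegree_lt (Nat.lt_succ_of_le hg)] using hN
  | of_succ j hj ih =>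
    have := ih (by omega)
    have := hf (j + 1) (by omega) hj
    constructor <;> linarith [hsucc j]

theorem X_add_one_dvd_gaussPoly {θ : ℝ} (hθ : 0 < θ) {t : ℕ}
    (ht : (2 * t + 1 : ℕ) * θ < Real.pi) : X + 1 ∣ gaussPoly θ (2 * t + 1) := by
  have hroot : aeval ((-1 : ℝ) : ℂ) (gaussPoly θ (2 * t + 1)) = 0 :=
    aeval_gaussPoly_eq_zero hθ ht (k := t) (by omega) (by simp)
  rw [← C_1, ← sub_neg_eq_add, ← C_neg, dvd_iff_isRoot, IsRoot, ← Complex.ofReal_eq_zero]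
  rwa [← Complex.coe_algebraMap, ← aeval_algebraMap_apply_eq_algebraMap_eval]

theorem exists_gaussPoly_eq_X_add_one_mul {θ : ℝ} (hθ : 0 < θ) {t : ℕ}
    (ht : (2 * t + 2 : ℕ) * θ < Real.pi) :
    ∃ g : ℝ[X], gaussPoly θ (2 * t + 1) = (X + 1) * g ∧ g.natDegree ≤ 2 * t ∧
      ∀ j ≤ 2 * t, 0 < g.coeff j := by
  have ht' : (2 * t + 1 : ℕ) * θ < Real.pi := lt_of_le_of_lt (by gcongr; omega) ht
  obtain ⟨g, hg⟩ := X_add_one_dvd_gaussPoly hθ ht'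
  have hg0 : g ≠ 0 := by
    rintro rfl
    simpa using congrArg (coeff · 0) hg
  have hdeg : g.natDegree ≤ 2 * t := by
    have hle := natDegree_gaussPoly_le θ (2 * t + 1)
    rw [hg, ← C_1, (monic_X_add_C (1 : ℝ)).natDegree_mul' hg0, natDegree_X_add_C] at hle
    omega
  refine ⟨g, hg, hdeg, fun j hj => ?_⟩
  rcases le_total j t with hjt | hjt
  · refine coeff_pos_of_coeff_lt_coeff_succ hg (by simp) (fun i hi => ?_) hjt
    simpa using gaussCoeff_lt_succ hθ ht (by omega)
  · refine coeff_pos_of_coeff_succ_lt_coeff hg hdeg ?_ (fun i hi hi' => ?_) hjt hj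
    · simpa using gaussCoeff_pos hθ ht' le_rfl
    · simpa using gaussCoeff_succ_lt hθ ht (by omega) (by omega)

theorem coeff_gaussPoly_comp_neg_X (θ : ℝ) (M j : ℕ) :
    ((gaussPoly θ M).comp (-X)).coeff j = (-1) ^ j * gaussCoeff θ M j := by
  rw [← neg_one_mul (X : ℝ[X]), ← C_1, ← C_neg, comp_C_mul_X_coeff, coeff_gaussPoly, mul_comm]

theorem natDegree_gaussPoly_comp_neg_X_le (θ : ℝ) (M : ℕ) :
    ((gaussPoly θ M).comp (-X)).natDegree ≤ M := by
  rw [natDegree_comp, natDegree_neg, natDegree_X, mul_one]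
  exact natDegree_gaussPoly_le θ M

theorem aeval_gaussPoly_comp_neg_X (θ : ℝ) (M : ℕ) (z : ℂ) :
    aeval z ((gaussPoly θ M).comp (-X)) = aeval (-z) (gaussPoly θ M) := by
  simp [aeval_comp]

theorem attainsCodim_odd_even {h s : ℕ} (hs : 0 < s) (hsh : 2 * s < h) :
    AttainsCodim (2 * s + 1) (h + (h - 2 * s)) (2 * s * (h + (h - 2 * s) - 1)) := by
  have hθ : 0 < Real.pi / h := div_pos Real.pi_pos (Nat.cast_pos.2 (by omega))
  refine attainsCodim_of_coeff (P := (gaussPoly (Real.pi / h) (2 * s)).comp (-X))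
    (V := gaussPoly (Real.pi / h) (h - 2 * s)) (by omega) (by omega) (by omega)
    (Nat.lt_succ_of_le (natDegree_gaussPoly_comp_neg_X_le _ _)) (fun j hj => ?_)
    (natDegree_gaussPoly_le _ _) (fun j hj => ?_) (fun z hz => ?_)
  · rw [coeff_gaussPoly_comp_neg_X]
    exact mul_ne_zero (pow_ne_zero _ (by norm_num))
      (gaussCoeff_pos hθ (natCast_mul_pi_div_lt_pi hsh) (by omega)).ne'
  · rw [coeff_gaussPoly]
    exact gaussCoeff_pos hθ (natCast_mul_pi_div_lt_pi (by omega)) hj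
  · rw [aeval_gaussPoly_comp_neg_X]
    exact aeval_gaussPoly_eq_zero_or hs hsh hz

theorem coeff_X_add_one_mul_gaussPoly_comp_neg_X_ne_zero {θ : ℝ} (hθ : 0 < θ) {s : ℕ}
    (hs : (2 * s + 1 : ℕ) * θ < Real.pi) {j : ℕ} (hj : j ≤ 2 * s + 1) :
    ((X + 1) * (gaussPoly θ (2 * s)).comp (-X)).coeff j ≠ 0 := by
  have hs' : (2 * s : ℕ) * θ < Real.pi := lt_of_le_of_lt (by gcongr; omega) hs
  rcases j with _ | j
  · simp [add_mul, coeff_gaussPoly_comp_neg_X]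
  · have hne : gaussCoeff θ (2 * s) j ≠ gaussCoeff θ (2 * s) (j + 1) := by
      rcases lt_or_ge j s with hjs | hjs
      · exact (gaussCoeff_lt_succ hθ hs (by omega)).ne
      · rcases (show j ≤ 2 * s by omega).eq_or_lt with rfl | hjM
        · rw [gaussCoeff_eq_zero (Nat.lt_succ_self _)]
          exact (gaussCoeff_pos hθ hs' le_rfl).ne'
        · exact (gaussCoeff_succ_lt hθ hs (by omega) hjM).ne'
    rw [add_mul, one_mul, coeff_add, coeff_X_mul, coeff_gaussPoly_comp_neg_X,
      coeff_gaussPoly_comp_neg_X, pow_succ]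
    convert mul_ne_zero (pow_ne_zero j (neg_ne_zero.2 one_ne_zero)) (sub_ne_zero.2 hne) using 1
    ring

theorem attainsCodim_even_odd {h s : ℕ} (hs : 0 < s) (hsh : 2 * s + 1 < h) (hodd : Odd h) :
    AttainsCodim (2 * s + 2) (h + (h - 2 * s - 1)) ((2 * s + 1) * (h + (h - 2 * s - 1) - 1)) := by
  have hθ : 0 < Real.pi / h := div_pos Real.pi_pos (Nat.cast_pos.2 (by omega))
  obtain ⟨t, ht⟩ : ∃ t, h - 2 * s = 2 * t + 1 := by
    obtain ⟨r, rfl⟩ := hodd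
    exact ⟨r - s, by omega⟩
  obtain ⟨V, hgV, hV, hVpos⟩ := exists_gaussPoly_eq_X_add_one_mul hθ (t := t)
    (natCast_mul_pi_div_lt_pi (by omega))
  refine attainsCodim_of_coeff (P := (X + 1) * (gaussPoly (Real.pi / h) (2 * s)).comp (-X))
    (V := V) (by omega) (by omega) (by omega) ?_ (fun j hj => ?_)
    (hV.trans (by omega)) (fun j hj => hVpos j (by omega)) (fun z hz => ?_)
  · have hX : (X + 1 : ℝ[X]).natDegree ≤ 1 := by rw [← C_1, natDegree_X_add_C]
    have := natDegree_mul_le_of_le hX (natDegree_gaussPoly_comp_neg_X_le (Real.pi / h) (2 * s))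
    omega
  · exact coeff_X_add_one_mul_gaussPoly_comp_neg_X_ne_zero hθ
      (natCast_mul_pi_div_lt_pi hsh) (by omega)
  · have hroot := aeval_gaussPoly_eq_zero_or hs (by omega) hz
    rw [ht, hgV, map_mul, mul_eq_zero] at hroot
    rw [map_mul, mul_eq_zero, aeval_gaussPoly_comp_neg_X]
    tauto

/-! ### Division with remainder -/

theorem attainsCodim_of_odd_of_odd {m q : ℕ} (hm : Odd m) (hq : Odd q) (hm3 : 3 ≤ m)
    (hmq : m < q + 2) : AttainsCodim m (q + 1) ((m - 1) * q) := by
  obtain ⟨s, rfl⟩ := hm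
  obtain ⟨t, rfl⟩ := hq
  have h := attainsCodim_odd_even (h := s + t + 1) (s := s) (by omega) (by omega)
  rwa [show s + t + 1 + (s + t + 1 - 2 * s) = 2 * t + 1 + 1 by omega] at h

theorem attainsCodim_of_even_of_lt {m q : ℕ} (hm : Even m) (hq : Even q) (hq0 : 0 < q)
    (hqm : q < m) : AttainsCodim m (q + 1) ((m - 1) * q) := by
  have h := attainsCodim_of_odd_of_odd hq.add_one (q := m - 1)
    (Nat.Even.sub_odd (by omega) hm odd_one) (by grind) (by omega)
  rw [Nat.sub_add_cancel (by omega), Nat.add_sub_cancel, mul_comm] at h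
  exact h.swap

theorem attainsCodim_of_even_of_mod_four {m q : ℕ} (hm : Even m) (hm4 : 4 ≤ m) (hmq : m ≤ q)
    (hmod : (m + q) % 4 = 2) : AttainsCodim m (q + 1) ((m - 1) * q) := by
  obtain ⟨s, rfl⟩ : ∃ s, m = 2 * s + 2 := ⟨m / 2 - 1, by grind⟩
  obtain ⟨t, rfl⟩ : ∃ t, q = 2 * t := ⟨q / 2, by omega⟩
  have h := attainsCodim_even_odd (h := s + t + 1) (s := s) (by omega) (by omega)
    (Nat.odd_iff.2 (by omega))
  rwa [show s + t + 1 + (s + t + 1 - 2 * s - 1) = 2 * t + 1 by omega] at h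

theorem attainsCodim_of_even {m q : ℕ} (hm : Even m) (hm4 : 4 ≤ m) (hq : Even q) :
    AttainsCodim m (q + 2) ((m - 1) * q) := by
  rcases q.eq_zero_or_pos with rfl | hq0
  · exact .zero m 2
  rcases lt_or_ge q m with hqm | hqm
  · exact (attainsCodim_of_even_of_lt hm hq hq0 hqm).mono le_rfl (by omega)
  rcases (show (m + q) % 4 = 2 ∨ (m + q) % 4 = 0 by grind) with hmod | hmod
  · exact (attainsCodim_of_even_of_mod_four hm hm4 hqm hmod).mono le_rfl (by omega)
  obtain ⟨q, rfl⟩ := Nat.exists_eq_add_of_le' (show 2 ≤ q by omega)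
  have hbase : AttainsCodim m (q + 1) ((m - 1) * q) := by
    rcases lt_or_ge q m with hqm' | hqm'
    · exact attainsCodim_of_even_of_lt hm (by grind) (by omega) hqm'
    · exact attainsCodim_of_even_of_mod_four hm hm4 hqm' (by omega)
  rw [mul_add]
  exact hbase.add_cols (attainsCodim_of_even_of_lt hm even_two two_pos (by omega))

theorem attainsCodim_three_four_of_le {l : ℕ} (hl : 4 ≤ l) (hl' : l ≤ 6) :
    AttainsCodim 3 4 l := by
  interval_cases l
  · exact attainsCodim_three_three.mono le_rfl (by norm_num)
  · exact attainsCodim_three_four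
  · exact attainsCodim_of_odd_of_odd (by decide) (by decide) le_rfl (by norm_num) (q := 3)

theorem attainsCodim_four_four_of_le {l : ℕ} (hl : 4 ≤ l) (hl' : l ≤ 7) :
    AttainsCodim 4 4 l := by
  rcases hl'.eq_or_lt with rfl | hl'
  · exact attainsCodim_four_four
  · exact (attainsCodim_three_four_of_le hl (by omega)).mono (by norm_num) le_rfl

theorem attainsCodim_four_seven_of_le {l : ℕ} (hl : 4 ≤ l) (hl' : l ≤ 13) :
    AttainsCodim 4 7 l := by
  rcases le_or_gt l 7 with hl7 | hl7
  · exact (attainsCodim_four_four_of_le hl hl7).mono le_rfl (by norm_num)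
  · have h := (attainsCodim_three_four_of_le (l := min 6 (l - 4)) (by omega) (by omega)).swap
    have := h.add_cols (attainsCodim_four_four_of_le (l := l - min 6 (l - 4)) (by omega) (by omega))
    rwa [show min 6 (l - 4) + (l - min 6 (l - 4)) = l by omega] at this

theorem attainsCodim_seven_of_le {m l : ℕ} (hm : 3 ≤ m) (hl : 4 ≤ l) (hl' : l ≤ 3 * (m - 1)) :
    AttainsCodim m 7 l := by
  induction m using Nat.strong_induction_on generalizing l with
  | _ m ih =>
    rcases hm.eq_or_lt with rfl | hm4
    · exact (attainsCodim_three_four_of_le hl hl').mono le_rfl (by norm_num)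
    rcases le_or_gt l 13 with hl13 | hl13
    · exact (attainsCodim_four_seven_of_le hl hl13).mono hm4 le_rfl
    have hten : AttainsCodim 3 7 10 :=
      attainsCodim_three_three.add_cols (attainsCodim_three_four_of_le (by norm_num) le_rfl)
    have h := hten.add_rows (ih (m - 3) (by omega) (l := l - 10) (by omega) (by omega) (by omega))
    rwa [show 3 + (m - 3) = m by omega, show 10 + (l - 10) = l by omega] at h

theorem AttainsCodim.of_add_seven_cols {m n q c l : ℕ} (h : AttainsCodim m q c) (hm : 3 ≤ m)
    (hn : q + 7 ≤ n) (hl : c + 4 ≤ l) (hl' : l ≤ c + 3 * (m - 1)) : AttainsCodim m n l := by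
  obtain ⟨r, rfl⟩ := Nat.exists_eq_add_of_le (show c ≤ l by omega)
  exact (h.add_cols (attainsCodim_seven_of_le hm (by omega) (by omega))).mono le_rfl hn

theorem exists_eq_mul_add_of_four_le {d l : ℕ} (hd : 0 < d) (hl : 4 ≤ l) :
    ∃ t r, l = d * t + r ∧ 4 ≤ r ∧ r < d + 4 :=
  ⟨(l - 4) / d, (l - 4) % d + 4, by have := Nat.div_add_mod (l - 4) d; omega, by omega,
    by have := Nat.mod_lt (l - 4) hd; omega⟩

theorem attainsCodim_of_even_of_le {m N l : ℕ} (hm : Even m) (hm4 : 4 ≤ m) (hl : 4 ≤ l)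
    (hl' : l ≤ (m - 1) * N) : AttainsCodim m (N + 8) l := by
  obtain ⟨t, r, hlr, hr, hr'⟩ :=
    exists_eq_mul_add_of_four_le (show 0 < (m - 1) * 2 by omega) hl
  rw [mul_assoc] at hlr
  have htN : 2 * t < N := lt_of_mul_lt_mul_left (a := m - 1) (by omega) (Nat.zero_le _)
  exact (attainsCodim_of_even hm hm4 (even_two_mul t)).of_add_seven_cols (by omega) (by omega)
    (by omega) (by omega)

theorem attainsCodim_of_odd_of_mul_le {m N l : ℕ} (hm : Odd m) (hm4 : 4 ≤ m)
    (hl : (m - 1) * m + 4 ≤ l) (hl' : l ≤ (m - 1) * N) : AttainsCodim m (N + 8) l := by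
  obtain ⟨t, r, hlr, hr, hr'⟩ := exists_eq_mul_add_of_four_le (l := l - (m - 1) * m)
    (show 0 < (m - 1) * 2 by omega) (by omega)
  have hlq : l = (m - 1) * (m + 2 * t) + r := by
    rw [mul_add, ← mul_assoc]
    omega
  have hqN : m + 2 * t < N := lt_of_mul_lt_mul_left (a := m - 1) (by omega) (Nat.zero_le _)
  exact (attainsCodim_of_odd_of_odd hm (hm.add_even (even_two_mul t)) (by omega)
    (by omega)).of_add_seven_cols (by omega) (by omega) (by omega) (by omega)

theorem attainsCodim_of_odd_of_lt {m N l : ℕ} (hm : Odd m) (hm5 : 5 ≤ m) (hN : N ≤ m + 2)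
    (hl : (m - 2) * N < l) (hl' : l ≤ (m - 1) * N) : AttainsCodim m (N + 8) l := by
  have hN0 : N ≠ 0 := by
    rintro rfl
    omega
  obtain ⟨q, hq, hNq⟩ : ∃ q, Even q ∧ (N = q + 1 ∨ N = q + 2 ∧ N ≤ m + 1) := by
    rcases N.even_or_odd with hNe | hNo
    · exact ⟨N - 2, by grind, by grind⟩
    · exact ⟨N - 1, by grind, by grind⟩
  have hbase : AttainsCodim m (q + 2) ((m - 2) * q) :=
    (attainsCodim_of_even (Nat.Odd.sub_odd hm odd_one) (by omega) hq).mono (by omega) le_rfl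
  obtain ⟨p, rfl⟩ := Nat.exists_eq_add_of_le' (show 2 ≤ m by omega)
  simp only [Nat.add_sub_cancel, Nat.add_succ_sub_one] at hl hl' hbase
  refine hbase.of_add_seven_cols (by omega) (by omega) ?_ ?_
  · rcases hNq with rfl | ⟨rfl, -⟩ <;> linarith
  · rcases hNq with rfl | ⟨rfl, hNm⟩ <;> simp only [Nat.add_succ_sub_one] <;> linarith

theorem corollary2 (m n : ℕ) (hm : 4 ≤ m) (hn : 10 ≤ n) (l : ℕ) (hl : 4 ≤ l)
    (hl' : l ≤ (m - 1) * (n - 8)) : ExistsUPBWithMissing m n l := by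
  obtain ⟨N, rfl⟩ := Nat.exists_eq_add_of_le' (show 8 ≤ n by omega)
  rw [Nat.add_sub_cancel] at hl'
  refine AttainsCodim.existsUPBWithMissing ?_ (by omega)
  rcases m.even_or_odd with heven | hodd
  · exact attainsCodim_of_even_of_le heven hm hl hl'
  have hm5 : 5 ≤ m := by grind
  rcases le_or_gt l ((m - 2) * N) with hlow | hhigh
  · have hpred : Even (m - 1) := Nat.Odd.sub_odd hodd odd_one
    exact (attainsCodim_of_even_of_le hpred (by omega) hl hlow).mono (by omega) le_rfl
  rcases le_or_gt N (m + 2) with hN | hN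
  · exact attainsCodim_of_odd_of_lt hodd hm5 hN hhigh hl'
  · refine attainsCodim_of_odd_of_mul_le hodd hm ?_ hl'
    obtain ⟨p, rfl⟩ := Nat.exists_eq_add_of_le' (show 2 ≤ m by omega)
    simp only [Nat.add_sub_cancel, Nat.add_succ_sub_one] at hhigh ⊢
    nlinarith
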